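/- Let $k$ be an infinite field (for example $k=\mathbb{C}$) and let $\tilde K$ be the field of formal power series $c_1t^{a_1}+c_2t^{a_2}+\cdots$ with coefficients $c_i\in k$ and real exponents $a_1<a_2<\cdots$ (finitely many, or tending to infinity). For a non-zero series $f$ let $\deg(f)\in\mathbb{R}$ be its smallest exponent. A tropical linear space over $k$ of dimension $r$ in $\mathbb{R}^d$ is the image under coordinatewise $\deg$ of $W\cap(\tilde K\setminus\{0\})^d$, where $W$ is an $r$-dimensional linear subspace of $\tilde K^d$. The Kapranov rank over $k$ of a matrix $M\in\mathbb{R}^{d\times n}$ is the smallest dimension of a tropical linear space over $k$ that contains all the columns of $M$. A real $r\times r$ matrix $A=(a_{ij})$ is tropically singular if the minimum of $a_{1\sigma(1)}+\cdots+a_{r\sigma(r)}$ over all permutations $\sigma$ of $\{1,\dots,r\}$ is attained by at least two permutations. The tropical rank of $M$ is the largest $r$ such that $M$ has a tropically non-singular $r\times r$ minor (square submatrix). **Theorem.** If a matrix $M\in\mathbb{R}^{d\times n}$ has tropical rank $2$, then its Kapranov rank over $k$ equals $2$. The same holds if $\tilde K$ is replaced, in the definition of the Kapranov rank, by any larger subfield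 of the field $k((t^{\mathbb{R}}))$ of Hahn series (all formal series whose set of real exponents is well-ordered), in particular by $k((t^{\mathbb{R}}))$ itself. -/

import Mathlib

/-- A square real matrix is *tropically singular* if the minimum over all permutations `σ` of
`∑ i, A i (σ i)` (the tropical determinant) is attained at least twice. -/
def IsTropicallySingular {r : ℕ} (A : Matrix (Fin r) (Fin r) ℝ) : Prop :=
  ∃ σ τ : Equiv.Perm (Fin r), σ ≠ τ ∧
    (∀ ρ : Equiv.Perm (Fin r), ∑ i, A i (σ i) ≤ ∑ i, A i (ρ i)) ∧
    (∀ ρ : Equiv.Perm (Fin r), ∑ i, A i (τ i) ≤ ∑ i, A i (ρ i))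

/-- `M` has a tropically non-singular `r × r` minor (rows and columns chosen in increasing
order). -/
def HasNonsingularMinor {d n : ℕ} (M : Matrix (Fin d) (Fin n) ℝ) (r : ℕ) : Prop :=
  ∃ (f : Fin r ↪o Fin d) (g : Fin r ↪o Fin n), ¬ IsTropicallySingular (M.submatrix f g)

/-- The sizes of minors are bounded, so the supremum below is a maximum. -/
theorem bddAbove_hasNonsingularMinor {d n : ℕ} (M : Matrix (Fin d) (Fin n) ℝ) :
    BddAbove {r : ℕ | HasNonsingularMinor M r} := by
  refine ⟨d, ?_⟩
  rintro r ⟨f, -, -⟩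
  simpa using Fintype.card_le_of_injective f f.injective

/-- The *tropical rank*: the largest `r` such that `M` has a non-singular `r × r` minor. -/
noncomputable def tropicalRank {d n : ℕ} (M : Matrix (Fin d) (Fin n) ℝ) : ℕ :=
  sSup {r : ℕ | HasNonsingularMinor M r}

/-- The sums `≤ B` of two sets of reals that are bounded below are finitely many if the sets have
only finitely many elements below suitable bounds. -/
theorem finite_sumset_le {S T : Set ℝ} {s t : ℝ} (hs : ∀ a ∈ S, s ≤ a) (ht : ∀ a ∈ T, t ≤ a)
    (B : ℝ) (hS : {a | a ∈ S ∧ a ≤ B - t}.Finite) (hT : {a | a ∈ T ∧ a ≤ B - s}.Finite) :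
    {a | (∃ x ∈ S, ∃ y ∈ T, x + y = a) ∧ a ≤ B}.Finite := by
  refine (Set.Finite.image2 (fun x y : ℝ => x + y) hS hT).subset ?_
  rintro a ⟨⟨x, hx, y, hy, rfl⟩, hB⟩
  have h1 := hs x hx
  have h2 := ht y hy
  exact ⟨x, ⟨hx, by linarith⟩, y, ⟨hy, by linarith⟩, rfl⟩

theorem HahnSeries.exists_support_bound {k : Type*} [Zero k] (x : HahnSeries ℝ k) :
    ∃ s : ℝ, ∀ a ∈ x.support, s ≤ a :=
  ⟨x.order, fun _ ha => HahnSeries.order_le_of_coeff_ne_zero ha⟩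

theorem HahnSeries.mem_support_mul {k : Type*} [Field k] {x y : HahnSeries ℝ k} {a : ℝ}
    (ha : a ∈ (x * y).support) : ∃ b ∈ x.support, ∃ c ∈ y.support, b + c = a :=
  Set.mem_add.1 (HahnSeries.support_mul_subset ha)

/-- The field of formal power series `c₁ t ^ a₁ + c₂ t ^ a₂ + ⋯` over `k` with real exponents
`a₁ < a₂ < ⋯`, finitely many or tending to infinity: the series
in the Hahn series field `k((t ^ ℝ))` having only finitely many exponents below every bound. -/
noncomputable def realPuiseux (k : Type*) [Field k] : Subfield (HahnSeries ℝ k) where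
  carrier := {x | ∀ B : ℝ, {a | a ∈ x.support ∧ a ≤ B}.Finite}
  zero_mem' := by
    intro B
    simp
  one_mem' := by
    intro B
    refine (Set.finite_singleton (0 : ℝ)).subset ?_
    rintro a ⟨ha, -⟩
    by_contra h
    exact ha (by simpa [HahnSeries.coeff_one] using h)
  add_mem' := by
    intro x y hx hy B
    refine ((hx B).union (hy B)).subset ?_
    rintro a ⟨ha, hB⟩
    rcases HahnSeries.support_add_subset _ _ ha with h | h
    · exact Or.inl ⟨h, hB⟩
    · exact Or.inr ⟨h, hB⟩
  neg_mem' := by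
    intro x hx B
    simpa using hx B
  mul_mem' := by
    intro x y hx hy B
    obtain ⟨s, hs⟩ := x.exists_support_bound
    obtain ⟨t, ht⟩ := y.exists_support_bound
    refine (finite_sumset_le hs ht B (hx _) (hy _)).subset ?_
    rintro a ⟨ha, hB⟩
    exact ⟨HahnSeries.mem_support_mul ha, hB⟩
  inv_mem' := by
    intro x hx
    by_cases hx0 : x = 0
    · subst hx0
      intro B
      simp
    obtain ⟨t, ht⟩ := (x⁻¹).exists_support_bound
    -- the exponents of `x` other than the smallest one exceed it by at least `m`
    have hm : ∃ m : ℝ, 0 < m ∧ ∀ a ∈ x.support, a ≠ x.order → x.order + m ≤ a := by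
      have hfin : {a | a ∈ x.support ∧ a ≤ x.order + 1 ∧ a ≠ x.order}.Finite :=
        (hx (x.order + 1)).subset fun a ha => ⟨ha.1, ha.2.1⟩
      rcases Set.eq_empty_or_nonempty
        {a | a ∈ x.support ∧ a ≤ x.order + 1 ∧ a ≠ x.order} with he | hne
      · refine ⟨1, one_pos, fun a ha hne => ?_⟩
        by_contra hlt
        have : a ∈ {a | a ∈ x.support ∧ a ≤ x.order + 1 ∧ a ≠ x.order} :=
          ⟨ha, (not_le.1 hlt).le, hne⟩
        rw [he] at this
        exact this
      · obtain ⟨b, hb, hmin⟩ := Set.exists_min_image _ (fun a : ℝ => a) hfin hne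
        have hob : x.order < b :=
          lt_of_le_of_ne (HahnSeries.order_le_of_coeff_ne_zero hb.1) (Ne.symm hb.2.2)
        refine ⟨b - x.order, sub_pos.2 hob, fun a ha hne => ?_⟩
        by_cases h1 : a ≤ x.order + 1
        · have := hmin a ⟨ha, h1, hne⟩
          linarith
        · have := hb.2.1
          linarith
    obtain ⟨m, hm0, hm⟩ := hm
    -- every exponent of the inverse is `-order` or arises from a smaller one
    have key : ∀ a ∈ (x⁻¹).support, a = -x.order ∨
        ∃ b ∈ {b | b ∈ x.support ∧ b ≠ x.order}, ∃ c ∈ (x⁻¹).support, b + c = x.order + a := by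
      intro a ha
      by_contra hcon
      push Not at hcon
      obtain ⟨hne, hcon⟩ := hcon
      have h1 : (x * x⁻¹).coeff (x.order + a) = 0 := by
        rw [mul_inv_cancel₀ hx0, HahnSeries.coeff_one, if_neg]
        intro h
        exact hne (by linarith)
      rw [HahnSeries.coeff_mul, Finset.sum_eq_single (x.order, a)] at h1
      · rcases mul_eq_zero.1 h1 with h | h
        · exact hx0 (HahnSeries.coeff_order_eq_zero.1 h)
        · exact ha h
      · rintro ⟨b, c⟩ hbc hne'
        rw [Finset.mem_antidiagonal] at hbc
        obtain ⟨hb, hc, hs⟩ := hbc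
        by_cases hbo : b = x.order
        · subst hbo
          exact (hne' (Prod.ext rfl (add_left_cancel hs))).elim
        · exact absurd hs (hcon b ⟨hb, hbo⟩ c hc)
      · intro h
        rw [Finset.mem_antidiagonal] at h
        exact absurd ⟨fun h0 => hx0 (HahnSeries.coeff_order_eq_zero.1 h0), ha, rfl⟩ h
    have step : ∀ N : ℕ, {a | a ∈ (x⁻¹).support ∧ a ≤ t + N * m}.Finite := by
      intro N
      induction N with
      | zero =>
        refine (Set.finite_singleton t).subset ?_
        rintro a ⟨ha, hle⟩
        have := ht a ha
        simp only [Nat.cast_zero, zero_mul, add_zero] at hle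
        exact le_antisymm hle this
      | succ N ih =>
        have hS : ∀ b ∈ {b | b ∈ x.support ∧ b ≠ x.order}, x.order + m ≤ b :=
          fun b hb => hm b hb.1 hb.2
        have hfin := finite_sumset_le hS ht (x.order + (t + (N + 1) * m))
          ((hx _).subset fun b hb => ⟨hb.1.1, hb.2⟩)
          (ih.subset fun b hb => ⟨hb.1, by linarith [hb.2]⟩)
        refine ((hfin.image fun a => a - x.order).union
          (Set.finite_singleton (-x.order))).subset ?_
        rintro a ⟨ha, hle⟩
        push_cast at hle
        rcases key a ha with h | h
        · exact Or.inr h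
        · exact Or.inl ⟨x.order + a, ⟨h, by linarith⟩, by ring⟩
    intro B
    obtain ⟨N, hN⟩ := exists_nat_ge ((B - t) / m)
    rw [div_le_iff₀ hm0] at hN
    exact (step N).subset fun a ha => ⟨ha.1, by linarith [ha.2]⟩

/-- `S ⊆ ℝ ^ d` is a *tropical linear space* of dimension `r` over the field `L` of power series:
it is the image, under the coordinatewise degree map `(L \ {0}) ^ d → ℝ ^ d`, of a linear subspace
of `L ^ d` of dimension `r` (of its points all of whose coordinates are non-zero, where the degree
map is defined). The degree of a non-zero series is its smallest exponent `HahnSeries.order`. -/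
def IsTropicalLinearSpace {k : Type*} [Field k] (L : Subfield (HahnSeries ℝ k)) {d : ℕ} (r : ℕ)
    (S : Set (Fin d → ℝ)) : Prop :=
  ∃ W : Submodule L (Fin d → L), Module.finrank L W = r ∧
    S = {w | ∃ x ∈ W, (∀ i, x i ≠ 0) ∧ ∀ i, (x i : HahnSeries ℝ k).order = w i}

/-- The *Kapranov rank* of `M` with respect to the field `L` of power series: the smallest
dimension of a tropical linear space containing the columns of `M`. -/
noncomputable def kapranovRank {k : Type*} [Field k] (L : Subfield (HahnSeries ℝ k)) {d n : ℕ}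
    (M : Matrix (Fin d) (Fin n) ℝ) : ℕ :=
  sInf {r : ℕ | ∃ S : Set (Fin d → ℝ), IsTropicalLinearSpace L r S ∧
    ∀ j : Fin n, (fun i => M i j) ∈ S}

/-! Scaling rows and columns by constants changes neither rank, so normalize `M` to `N` with a zero
column and with every column minimum equal to zero. If no `3 × 3` minor is nonsingular, no entry of
a `2 × 2` minor of `N` is strictly below the other three. This is a four-point condition: `N` looks
like ultrametric valuations of differences between row points and column points. Such points exist
as series: at each exponent the coefficient labels a ball, and an infinite `k` supplies enough
labels. With `p i - q j` of order `N i j`, every column of `M` lifts to a combination of the two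
vectors `t ^ c i * p i` and `t ^ c i`. Conversely, on a line all `2 × 2` determinants of lifts
vanish, which makes every `2 × 2` minor of `M` singular. -/

/-- A nonsingular square submatrix along injective index maps yields a nonsingular minor. -/
theorem HasNonsingularMinor.of_injective {d n r : ℕ} {M : Matrix (Fin d) (Fin n) ℝ}
    {f : Fin r → Fin d} {g : Fin r → Fin n} (hf : f.Injective) (hg : g.Injective)
    (h : ¬ IsTropicallySingular (M.submatrix f g)) : HasNonsingularMinor M r := by
  have hF : StrictMono (f ∘ Tuple.sort f) :=
    (Tuple.monotone_sort f).strictMono_of_injective (hf.comp (Tuple.sort f).injective)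
  have hG : StrictMono (g ∘ Tuple.sort g) :=
    (Tuple.monotone_sort g).strictMono_of_injective (hg.comp (Tuple.sort g).injective)
  refine ⟨OrderEmbedding.ofStrictMono _ hF, OrderEmbedding.ofStrictMono _ hG, ?_⟩
  rintro ⟨σ, τ, hne, hσ, hτ⟩
  generalize Tuple.sort f = a at *
  generalize Tuple.sort g = b at *
  change ∀ ρ : Equiv.Perm (Fin r),
    ∑ i, M (f (a i)) (g (b (σ i))) ≤ ∑ i, M (f (a i)) (g (b (ρ i))) at hσ
  change ∀ ρ : Equiv.Perm (Fin r),
    ∑ i, M (f (a i)) (g (b (τ i))) ≤ ∑ i, M (f (a i)) (g (b (ρ i))) at hτ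
  -- Conjugating by the two sorting permutations is a bijection on permutations that preserves the
  -- sums.
  have key : ∀ ρ : Equiv.Perm (Fin r), ∑ i, M (f (a i)) (g (b (ρ i))) =
      ∑ i, M (f i) (g (a.symm.trans (ρ.trans b) i)) := fun ρ => by
    simpa using Equiv.sum_comp a fun i => M (f i) (g (b (ρ (a.symm i))))
  have back : ∀ ρ : Equiv.Perm (Fin r),
      a.symm.trans ((a.trans (ρ.trans b.symm)).trans b) = ρ := fun ρ => by
    ext i
    simp
  refine h ⟨a.symm.trans (σ.trans b), a.symm.trans (τ.trans b), ?_, fun ρ => ?_, fun ρ => ?_⟩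
  · intro he
    refine hne (Equiv.ext fun i => ?_)
    simpa using Equiv.congr_fun he (a i)
  · have := hσ (a.trans (ρ.trans b.symm))
    rwa [key, key, back] at this
  · have := hτ (a.trans (ρ.trans b.symm))
    rwa [key, key, back] at this

theorem hasNonsingularMinor_tropicalRank {d n : ℕ} (M : Matrix (Fin d) (Fin n) ℝ) :
    HasNonsingularMinor M (tropicalRank M) := by
  refine Nat.sSup_mem ⟨0, ?_⟩ (bddAbove_hasNonsingularMinor M)
  -- The empty minor is nonsingular, having only one permutation, so the supremum is over a nonempty
  -- set.
  refine HasNonsingularMinor.of_injective (f := Fin.elim0) (g := Fin.elim0)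
    (Function.injective_of_subsingleton _) (Function.injective_of_subsingleton _) ?_
  rintro ⟨σ, τ, hne, -⟩
  exact hne (Subsingleton.elim _ _)

theorem HasNonsingularMinor.le_tropicalRank {d n r : ℕ} {M : Matrix (Fin d) (Fin n) ℝ}
    (h : HasNonsingularMinor M r) : r ≤ tropicalRank M :=
  le_csSup (bddAbove_hasNonsingularMinor M) h

/-- Adding constants to the rows and columns of a matrix preserves tropical singularity. -/
theorem IsTropicallySingular.of_scaling {r : ℕ} {A B : Matrix (Fin r) (Fin r) ℝ}
    {x y : Fin r → ℝ} (h : IsTropicallySingular A) (hB : ∀ i j, A i j = B i j + x i + y j) :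
    IsTropicallySingular B := by
  have key : ∀ ρ : Equiv.Perm (Fin r),
      ∑ i, A i (ρ i) = ∑ i, B i (ρ i) + (∑ i, x i + ∑ i, y i) := by
    intro ρ
    simp only [hB, Finset.sum_add_distrib, Equiv.sum_comp ρ y, add_assoc]
  obtain ⟨σ, τ, hne, hσ, hτ⟩ := h
  simp only [key, add_le_add_iff_right] at hσ hτ
  exact ⟨σ, τ, hne, hσ, hτ⟩

/-- A matrix with a strictly smallest permutation sum is tropically nonsingular. -/
theorem not_isTropicallySingular_of_forall_lt {r : ℕ} {A : Matrix (Fin r) (Fin r) ℝ}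
    (π : Equiv.Perm (Fin r))
    (h : ∀ ρ : Equiv.Perm (Fin r), ρ ≠ π → ∑ i, A i (π i) < ∑ i, A i (ρ i)) :
    ¬ IsTropicallySingular A := by
  rintro ⟨σ, τ, hne, hσ, hτ⟩
  by_cases hs : σ = π
  · exact absurd (hτ π) (not_le.2 (h τ fun ht => hne (hs.trans ht.symm)))
  · exact absurd (hσ π) (not_le.2 (h σ hs))

/-- A `3 × 3` matrix whose antidiagonal is the only minimal permutation. -/
theorem not_isTropicallySingular_fin_three {A : Matrix (Fin 3) (Fin 3) ℝ}
    (h1 : A 0 2 + A 1 1 + A 2 0 < A 0 0 + A 1 1 + A 2 2)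
    (h2 : A 0 2 + A 1 1 + A 2 0 < A 0 0 + A 1 2 + A 2 1)
    (h3 : A 0 2 + A 1 1 + A 2 0 < A 0 1 + A 1 0 + A 2 2)
    (h4 : A 0 2 + A 1 1 + A 2 0 < A 0 1 + A 1 2 + A 2 0)
    (h5 : A 0 2 + A 1 1 + A 2 0 < A 0 2 + A 1 0 + A 2 1) :
    ¬ IsTropicallySingular A := by
  refine not_isTropicallySingular_of_forall_lt (Equiv.swap 0 2) fun ρ hρ => ?_
  have e1 : Equiv.swap (0 : Fin 3) 2 1 = 1 := by decide
  have inj : ∀ i j, ρ i = ρ j → i = j := fun i j => ρ.injective.eq_iff.1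
  have i01 := inj 0 1
  have i02 := inj 0 2
  have i12 := inj 1 2
  have hn : ¬ (ρ 0 = 2 ∧ ρ 1 = 1 ∧ ρ 2 = 0) := by
    rintro ⟨a, b, c⟩
    refine hρ (Equiv.ext fun i => ?_)
    fin_cases i
    · simpa using a
    · simpa [e1] using b
    · simpa using c
  simp only [Fin.sum_univ_three, Equiv.swap_apply_left, Equiv.swap_apply_right, e1]
  generalize ρ 0 = a at *
  generalize ρ 1 = b at *
  generalize ρ 2 = c at *
  fin_cases a <;> fin_cases b <;> fin_cases c <;> simp at i01 i02 i12 hn ⊢ <;> linarith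

/-! ### Normalization and the four-point condition -/

/-- If `M` has no nonsingular `3 × 3` minor then its rows and columns can be scaled so that every
entry of a `2 × 2` minor is at least the minimum of the three others. -/
theorem exists_scaling_of_not_hasNonsingularMinor_three {d n : ℕ} {M : Matrix (Fin d) (Fin n) ℝ}
    (hM : ¬ HasNonsingularMinor M 3) (i₀ : Fin d) (j₀ : Fin n) :
    ∃ (c : Fin d → ℝ) (s : Fin n → ℝ) (N : Fin d → Fin n → ℝ),
      (∀ i j, M i j = N i j + c i + s j) ∧
      ∀ i i' j j', N i j < N i j' → N i j < N i' j → N i j < N i' j' → False := by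
  have hne : (Finset.univ : Finset (Fin d)).Nonempty := ⟨i₀, Finset.mem_univ _⟩
  choose m _ hm using fun j => Finset.exists_min_image Finset.univ (fun i => M i j - M i j₀) hne
  -- Subtracting column `j₀` makes it zero; then each column loses its minimum, attained in row `m
  -- j`.
  refine ⟨fun i => M i j₀, fun j => M (m j) j - M (m j) j₀,
    fun i j => M i j - M i j₀ - (M (m j) j - M (m j) j₀), fun i j => by ring, ?_⟩
  set N : Fin d → Fin n → ℝ := fun i j => M i j - M i j₀ - (M (m j) j - M (m j) j₀) with hN
  have hnn : ∀ i j, 0 ≤ N i j := fun i j => sub_nonneg.2 (hm j i (Finset.mem_univ _))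
  have hz : ∀ j, N (m j) j = 0 := fun j => sub_self _
  have hc : ∀ i, N i j₀ = 0 := fun i => by simp [hN]
  intro i i' j j' h1 h2 h3
  have p0 := hnn i j
  have hj0 : j ≠ j₀ := by
    rintro rfl
    rw [hc, hc] at h2
    exact lt_irrefl _ h2
  have hj0' : j' ≠ j₀ := by
    rintro rfl
    rw [hc] at h1
    linarith
  have hjj : j ≠ j' := by
    rintro rfl
    exact lt_irrefl _ h1
  have hii : i ≠ i' := by
    rintro rfl
    exact lt_irrefl _ h2
  have hmi : m j' ≠ i := by
    intro h
    have := hz j'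
    rw [h] at this
    linarith
  have hmi' : m j' ≠ i' := by
    intro h
    have := hz j'
    rw [h] at this
    linarith
  -- Bordering by the zero column `j₀` and by a row with a zero in column `j'` makes the
  -- antidiagonal sum `0 + N i j + 0` the unique minimum.
  refine hM (HasNonsingularMinor.of_injective (f := ![m j', i, i']) (g := ![j₀, j, j']) ?_ ?_ ?_)
  · intro a b
    fin_cases a <;> fin_cases b <;> simp [hii, hii.symm, hmi, hmi.symm, hmi', hmi'.symm]
  · intro a b
    fin_cases a <;> fin_cases b <;> simp [hjj, hjj.symm, hj0, hj0.symm, hj0', hj0'.symm]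
  · intro hs
    have hs' := hs.of_scaling (B := Matrix.of fun a b => N (![m j', i, i'] a) (![j₀, j, j'] b))
      (x := fun a => M (![m j', i, i'] a) j₀)
      (y := fun b => M (m (![j₀, j, j'] b)) (![j₀, j, j'] b) - M (m (![j₀, j, j'] b)) j₀)
      (fun a b => by simp only [hN, Matrix.submatrix_apply, Matrix.of_apply]; ring)
    have q1 := hnn (m j') j
    refine not_isTropicallySingular_fin_three ?_ ?_ ?_ ?_ ?_ hs' <;>
      simp only [Matrix.of_apply, Matrix.cons_val, hz, hc] <;> linarith

/-! ### Realization by power series -/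

theorem HahnSeries.order_eq_of_coeff {k : Type*} [Zero k] {x : HahnSeries ℝ k} {a : ℝ}
    (ha : x.coeff a ≠ 0) (h : ∀ b < a, x.coeff b = 0) : x ≠ 0 ∧ x.order = a := by
  have hx : x ≠ 0 := by
    rintro rfl
    simp at ha
  refine ⟨hx, le_antisymm (order_le_of_coeff_ne_zero ha) (not_lt.1 fun hlt => ?_)⟩
  exact hx (coeff_order_eq_zero.1 (h _ hlt))

theorem single_mem_realPuiseux {k : Type*} [Field k] (a : ℝ) (c : k) :
    HahnSeries.single a c ∈ realPuiseux k := fun _ =>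
  (Set.finite_singleton a).subset fun _ hb => HahnSeries.support_single_subset hb.1

/-- A finite bipartite system of valuations satisfying the ultrametric condition is realized by
differences of power series. -/
theorem exists_realPuiseux_order_sub {k : Type*} [Field k] [Infinite k] {d n : ℕ}
    (N : Fin d → Fin n → ℝ)
    (hN : ∀ i i' j j', N i j < N i j' → N i j < N i' j → N i j < N i' j' → False) :
    ∃ (p : Fin d → HahnSeries ℝ k) (q : Fin n → HahnSeries ℝ k),
      (∀ i, p i ∈ realPuiseux k) ∧ (∀ j, q j ∈ realPuiseux k) ∧
      ∀ i j, p i - q j ≠ 0 ∧ (p i - q j).order = N i j := by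
  classical
  obtain ⟨ξ⟩ : Nonempty (Set (Fin d) ↪ k) :=
    ⟨(Finite.equivFin _).toEmbedding.trans (Fin.valEmbedding.trans (Infinite.natEmbedding k))⟩
  let T : Finset ℝ := Finset.univ.image fun z : Fin d × Fin n => N z.1 z.2
  -- `A t i` and `B t j` are the balls of radius `t` around row `i` and column `j`, recorded by the
  -- rows they contain. Points in the same ball share the coefficient at `t`.
  let A : ℝ → Fin d → Set (Fin d) := fun t i => {i' | i' = i ∨ ∃ j, t < N i j ∧ t < N i' j}
  let B : ℝ → Fin n → Set (Fin d) := fun t j => {i' | t < N i' j}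
  have hlt : ∀ t i j, t < N i j → A t i = B t j := by
    intro t i j h
    ext i'
    constructor
    · rintro (rfl | ⟨j', h1, h2⟩)
      · exact h
      · by_contra h3
        have h3 : N i' j ≤ t := not_lt.1 h3
        exact hN i' i j j' (h3.trans_lt h2) (h3.trans_lt h) (h3.trans_lt h1)
    · intro h'
      exact Or.inr ⟨j, h, h'⟩
  -- At `t = N i j` the balls separate: row `i` is in its own ball but not in that of `j`.
  have hne : ∀ i j, A (N i j) i ≠ B (N i j) j := by
    intro i j h
    have : i ∈ B (N i j) j := h ▸ Or.inl rfl
    exact lt_irrefl (N i j) this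
  have hco : ∀ (F : ℝ → k) (s : ℝ),
      (∑ t ∈ T, HahnSeries.single t (F t)).coeff s = if s ∈ T then F s else 0 := by
    intro F s
    rw [HahnSeries.coeff_sum]
    simp only [HahnSeries.coeff_single]
    exact Finset.sum_ite_eq T s F
  refine ⟨fun i => ∑ t ∈ T, HahnSeries.single t (ξ (A t i)),
    fun j => ∑ t ∈ T, HahnSeries.single t (ξ (B t j)),
    fun i => sum_mem fun t _ => single_mem_realPuiseux t _,
    fun j => sum_mem fun t _ => single_mem_realPuiseux t _, fun i j => ?_⟩
  have hT : N i j ∈ T := Finset.mem_image.2 ⟨(i, j), Finset.mem_univ _, rfl⟩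
  apply HahnSeries.order_eq_of_coeff
  · rw [HahnSeries.coeff_sub, hco (fun t => ξ (A t i)), hco (fun t => ξ (B t j)), if_pos hT,
      if_pos hT]
    exact sub_ne_zero.2 fun h => hne i j (ξ.injective h)
  · intro s hs
    rw [HahnSeries.coeff_sub, hco (fun t => ξ (A t i)), hco (fun t => ξ (B t j)), hlt s i j hs,
      sub_self]

/-! ### Bounds on the dimension -/

/-- A tropical linear space containing the columns of a matrix with a nonsingular `2 × 2` minor
has dimension at least `2`. -/
theorem two_le_of_isTropicalLinearSpace {k : Type*} [Field k] {L : Subfield (HahnSeries ℝ k)}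
    {d n r : ℕ} {M : Matrix (Fin d) (Fin n) ℝ} (hM : HasNonsingularMinor M 2)
    {S : Set (Fin d → ℝ)} (hS : IsTropicalLinearSpace L r S)
    (hcol : ∀ j, (fun i => M i j) ∈ S) : 2 ≤ r := by
  obtain ⟨W, hW, rfl⟩ := hS
  by_contra hr
  have hle : Module.finrank L W ≤ 1 := by omega
  obtain ⟨v, hv⟩ := finrank_le_one_iff.1 hle
  obtain ⟨f, g, hfg⟩ := hM
  obtain ⟨x, hxW, hx0, hx⟩ := hcol (g 0)
  obtain ⟨y, hyW, hy0, hy⟩ := hcol (g 1)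
  obtain ⟨a, ha⟩ := hv ⟨x, hxW⟩
  obtain ⟨b, hb⟩ := hv ⟨y, hyW⟩
  have hxa : ∀ i, x i = a * v.1 i := fun i => (congrFun (congrArg Subtype.val ha) i).symm
  have hyb : ∀ i, y i = b * v.1 i := fun i => (congrFun (congrArg Subtype.val hb) i).symm
  -- The lifts are proportional; taking orders equates the two permutation sums.
  have hcross : x (f 0) * y (f 1) = y (f 0) * x (f 1) := by
    rw [hxa, hxa, hyb, hyb]
    ring
  have hc : ∀ {z : L}, z ≠ 0 → (z : HahnSeries ℝ k) ≠ 0 := fun h h' => h (Subtype.ext h')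
  have hord := congrArg (fun z : L => (z : HahnSeries ℝ k).order) hcross
  simp only [Subfield.coe_mul] at hord
  rw [HahnSeries.order_mul (hc (hx0 _)) (hc (hy0 _)),
    HahnSeries.order_mul (hc (hy0 _)) (hc (hx0 _)), hx, hx, hy, hy] at hord
  have hall : ∀ ρ : Equiv.Perm (Fin 2),
      ∑ i, (M.submatrix f g) i (ρ i) = M (f 0) (g 0) + M (f 1) (g 1) := by
    intro ρ
    have h01 : ρ = 1 ∨ ρ = Equiv.swap 0 1 := by
      revert ρ
      decide
    rcases h01 with rfl | rfl
    · simp [Fin.sum_univ_two]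
    · simp [Fin.sum_univ_two, hord]
  refine hfg ⟨1, Equiv.swap 0 1, by decide, fun ρ => ?_, fun ρ => ?_⟩ <;> rw [hall, hall]

/-- If `M` has no nonsingular `3 × 3` minor then its columns lie in a tropical linear space of
dimension at most `2`. -/
theorem exists_isTropicalLinearSpace_le_two {k : Type*} [Field k] [Infinite k]
    {L : Subfield (HahnSeries ℝ k)} (hL : realPuiseux k ≤ L) {d n : ℕ}
    {M : Matrix (Fin d) (Fin n) ℝ} (hM : ¬ HasNonsingularMinor M 3) (i₀ : Fin d) (j₀ : Fin n) :
    ∃ r ≤ 2, ∃ S : Set (Fin d → ℝ), IsTropicalLinearSpace L r S ∧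
      ∀ j, (fun i => M i j) ∈ S := by
  obtain ⟨c, s, N, hMN, hN⟩ := exists_scaling_of_not_hasNonsingularMinor_three hM i₀ j₀
  obtain ⟨p, q, hp, hq, hpq⟩ := exists_realPuiseux_order_sub (k := k) N hN
  let τ : ℝ → L := fun a => ⟨HahnSeries.single a 1, hL (single_mem_realPuiseux a 1)⟩
  let P : Fin d → L := fun i => ⟨p i, hL (hp i)⟩
  let Q : Fin n → L := fun j => ⟨q j, hL (hq j)⟩
  let u : Fin d → L := fun i => τ (c i) * P i
  let w : Fin d → L := fun i => τ (c i)
  -- Independence of `u` and `w` is not needed: the lower bound later forces dimension `2`.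
  have hr : Module.finrank L (Submodule.span L {u, w}) ≤ 2 := by
    classical
    have h := finrank_span_finset_le_card (R := L) ({u, w} : Finset (Fin d → L))
    rw [Finset.coe_pair] at h
    exact h.trans Finset.card_le_two
  refine ⟨_, hr, _, ⟨Submodule.span L {u, w}, rfl, rfl⟩, fun j => ?_⟩
  have hτ : ∀ a, (τ a : HahnSeries ℝ k) ≠ 0 := fun a =>
    HahnSeries.single_ne_zero one_ne_zero
  have hτo : ∀ a, (τ a : HahnSeries ℝ k).order = a := fun a =>
    HahnSeries.order_single one_ne_zero
  have hval : ∀ i, ((τ (s j) • (u - Q j • w)) i : HahnSeries ℝ k) =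
      τ (s j) * (τ (c i) * (p i - q j)) := by
    intro i
    change (τ (s j) : HahnSeries ℝ k) * (τ (c i) * p i - q j * τ (c i)) = _
    ring
  -- Coordinate `i` of this lift is `t ^ s j * t ^ c i * (p i - q j)`, of order `s j + c i + N i j =
  -- M i j`.
  refine ⟨τ (s j) • (u - Q j • w), ?_, fun i h => ?_, fun i => ?_⟩
  · exact Submodule.smul_mem _ _ (Submodule.sub_mem _ (Submodule.subset_span (by simp))
      (Submodule.smul_mem _ _ (Submodule.subset_span (by simp))))
  · have h' := hval i
    rw [h] at h'
    exact mul_ne_zero (hτ _) (mul_ne_zero (hτ _) (hpq i j).1) h'.symm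
  · rw [hval, HahnSeries.order_mul (hτ _) (mul_ne_zero (hτ _) (hpq i j).1),
      HahnSeries.order_mul (hτ _) (hpq i j).1, hτo, hτo, (hpq i j).2]
    change _ = M i j
    rw [hMN]
    ring

theorem theorem6p5 (k : Type*) [Field k] [Infinite k]
    (L : Subfield (HahnSeries ℝ k)) (hL : realPuiseux k ≤ L)
    {d n : ℕ} (M : Matrix (Fin d) (Fin n) ℝ) (hM : tropicalRank M = 2) :
    kapranovRank L M = 2 := by
  have h2 : HasNonsingularMinor M 2 := hM ▸ hasNonsingularMinor_tropicalRank M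
  have h3 : ¬ HasNonsingularMinor M 3 := fun h => by
    have := h.le_tropicalRank
    omega
  obtain ⟨f, g, -⟩ := id h2
  obtain ⟨r, hr, S, hS, hcol⟩ := exists_isTropicalLinearSpace_le_two hL h3 (f 0) (g 0)
  obtain rfl : r = 2 := le_antisymm hr (two_le_of_isTropicalLinearSpace h2 hS hcol)
  refine le_antisymm (Nat.sInf_le ⟨S, hS, hcol⟩) (le_csInf ⟨2, S, hS, hcol⟩ ?_)
  rintro m ⟨S', hS', hcol'⟩
  exact two_le_of_isTropicalLinearSpace h2 hS' hcol'
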